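/- Let $f_1,f_2:\mathbb R\to\mathbb R$ be $C^2$, let $\mathcal P=\{(f_1(w),f_2(w)):w\in\mathbb R\}\subseteq\mathbb R^2$ be the (possibly self-intersected) physical desired path, and let $k_1,k_2,s,k_\theta>0$. For $p=(x,y,w)\in\mathbb R^3$ put $\phi_1(p)=x-f_1(w)$, $\phi_2(p)=y-f_2(w)$, and $$\chi(p)=\nabla\phi_1(p)\times\nabla\phi_2(p)-\sum_{i=1}^2k_i\phi_i(p)\nabla\phi_i(p).$$ Write $\hat v=v/\|v\|$, $\chi^p=(\hat\chi_1,\hat\chi_2)^\top$, $E=\begin{bmatrix}0&-1\\1&0\end{bmatrix}$, $h=(\cos\theta,\sin\theta)^\top$, and let $J(\chi^p)$ be the $2\times3$ Jacobian matrix of $\chi^p$ with respect to $p$. Consider a unicycle $\dot x=v_u\cos\theta$, $\dot y=v_u\sin\theta$, $\dot\theta=\omega_u$ together with a virtual coordinate $w$, under the law $$\dot w=s\hat\chi_3,\qquad v_u=s\|\chi^p\|,\qquad \omega_u=\dot\theta_d-k_\theta\,\hat h^\top E\,\widehat{\chi^p},\qquad \dot\theta_d=-\frac1{\|\chi^p\|}\,\widehat{\chi^p}^\top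 E\,J(\chi^p)\,\dot p,$$ where everything is evaluated along $p(t)=(x(t),y(t),w(t))$ and $\dot p=(\dot x,\dot y,\dot w)^\top$ is the generalized velocity. Let $(p(t),\theta(t))$, $t\ge0$, be a trajectory of this closed-loop system such that $\chi_1(p(t))^2+\chi_2(p(t))^2\ne0$ for all $t\ge0$, and let $\beta(t)\in(-\pi,\pi]$ be the angle directed from $\widehat{\chi^p}$ to $\hat h$ at time $t$. If $\beta(0)\in(-\pi,\pi)$, then, as $t\to\infty$, $\beta(t)\to0$, the generalized velocity converges to the scaled vector field, $\dot p(t)-s\hat\chi(p(t))\to0$, and the robot's trajectory converges to the physical desired path, $\operatorname{dist}\big((x(t),y(t)),\mathcal P\big)\to0$. -/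

import Mathlib

open Real Set Filter Topology
open scoped Gradient Matrix

namespace UnicycleVF

noncomputable section

/-- The plane with its Euclidean norm. -/
abbrev E2 := EuclideanSpace ℝ (Fin 2)

/-- Generalized positions `p = (x, y, w)`, with the Euclidean norm. -/
abbrev E3 := EuclideanSpace ℝ (Fin 3)

/-- The physical desired path `{(f₁ w, f₂ w) : w ∈ ℝ}` in the plane. -/
def physicalPath (f : Fin 2 → ℝ → ℝ) : Set E2 :=
  Set.range fun w : ℝ => (!₂[f 0 w, f 1 w] : E2)

/-- The surface functions `φ₁(x, y, w) = x - f₁ w` and `φ₂(x, y, w) = y - f₂ w`. -/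
def surface (f : Fin 2 → ℝ → ℝ) (i : Fin 2) (p : E3) : ℝ :=
  p i.castSucc - f i (p 2)

/-- The cross product of Euclidean 3-space. -/
def cross (a b : E3) : E3 :=
  WithLp.toLp 2 (crossProduct a.ofLp b.ofLp)

/-- The guiding vector field of two surface functions with gains `k`:
`∇φ₁ × ∇φ₂ - ∑ i, k i * φ i * ∇φ i`. -/
def guidingField (φ : Fin 2 → E3 → ℝ) (k : Fin 2 → ℝ) (p : E3) : E3 :=
  cross (∇ (φ 0) p) (∇ (φ 1) p) - ∑ i : Fin 2, (k i * φ i p) • ∇ (φ i) p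

/-- The 3D vector field `χ` of the path parametrized by `f`. -/
def field (f : Fin 2 → ℝ → ℝ) (k : Fin 2 → ℝ) : E3 → E3 :=
  guidingField (surface f) k

/-- The normalized field `χ / ‖χ‖`. -/
def fieldHat (f : Fin 2 → ℝ → ℝ) (k : Fin 2 → ℝ) (p : E3) : E3 :=
  NormedSpace.normalize (field f k p)

/-- The planar part `χᵖ` of the normalized field: its first two entries. -/
def planarField (f : Fin 2 → ℝ → ℝ) (k : Fin 2 → ℝ) (p : E3) : E2 :=
  !₂[fieldHat f k p 0, fieldHat f k p 1]

/-- The normalization of `χᵖ`. -/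
def planarFieldHat (f : Fin 2 → ℝ → ℝ) (k : Fin 2 → ℝ) (p : E3) : E2 :=
  NormedSpace.normalize (planarField f k p)

/-- The heading vector `h = (cos θ, sin θ)`. -/
def heading (θ : ℝ) : E2 := !₂[cos θ, sin θ]

/-- The rotation of the plane by 90 degrees. -/
def rotE : E2 →ₗ[ℝ] E2 := Matrix.toEuclideanLin !![0, -1; 1, 0]

/-- The angle in `(-π, π]` directed from `u` to `v` (for nonzero `u` and `v`): the argument of the
complex number with real part `u₁ v₁ + u₂ v₂` and imaginary part `u₁ v₂ - u₂ v₁`. -/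
def directedAngle (u v : E2) : ℝ :=
  Complex.arg ⟨u 0 * v 0 + u 1 * v 1, u 0 * v 1 - u 1 * v 0⟩

/-- The heading error `β`: the angle directed from the normalized `χᵖ` to the normalized heading. -/
def headingError (f : Fin 2 → ℝ → ℝ) (k : Fin 2 → ℝ) (p : E3) (θ : ℝ) : ℝ :=
  directedAngle (planarFieldHat f k p) (NormedSpace.normalize (heading θ))

/-- The speed input `v_u = s ‖χᵖ‖`. -/
def speedInput (f : Fin 2 → ℝ → ℝ) (k : Fin 2 → ℝ) (s : ℝ) (p : E3) : ℝ :=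
  s * ‖planarField f k p‖

/-- The rate of the desired heading,
`-(1 / ‖χᵖ‖) (normalized χᵖ)ᵀ E J(χᵖ) pdot`, at the generalized velocity `pdot`. -/
def desiredRate (f : Fin 2 → ℝ → ℝ) (k : Fin 2 → ℝ) (p pdot : E3) : ℝ :=
  (-1 / ‖planarField f k p‖) *
    inner ℝ (planarFieldHat f k p) (rotE (fderiv ℝ (planarField f k) p pdot))

/-- The angular rate input `ω_u`: the desired rate minus
`kθ (normalized h)ᵀ E (normalized χᵖ)`. -/
def angularInput (f : Fin 2 → ℝ → ℝ) (k : Fin 2 → ℝ) (kθ : ℝ) (p pdot : E3) (θ : ℝ) : ℝ :=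
  desiredRate f k p pdot -
    kθ * inner ℝ (NormedSpace.normalize (heading θ)) (rotE (planarFieldHat f k p))

/-- `p = (x, y, w)` and `θ` are a trajectory, on the time interval `[0, ∞)`, of the unicycle
under the control law together with the virtual dynamics; `pdot` is the generalized velocity. -/
structure IsClosedLoop (f : Fin 2 → ℝ → ℝ) (k : Fin 2 → ℝ) (s kθ : ℝ)
    (p pdot : ℝ → E3) (θ : ℝ → ℝ) : Prop where
  velocity : ∀ t : ℝ, 0 ≤ t → HasDerivWithinAt p (pdot t) (Set.Ici 0) t
  x_eq : ∀ t : ℝ, 0 ≤ t → pdot t 0 = speedInput f k s (p t) * cos (θ t)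
  y_eq : ∀ t : ℝ, 0 ≤ t → pdot t 1 = speedInput f k s (p t) * sin (θ t)
  w_eq : ∀ t : ℝ, 0 ≤ t → pdot t 2 = s * fieldHat f k (p t) 2
  θ_eq : ∀ t : ℝ, 0 ≤ t →
    HasDerivWithinAt θ (angularInput f k kθ (p t) (pdot t) (θ t)) (Set.Ici 0) t

end

end UnicycleVF

namespace UnicycleVF

/-! The desired rate is the angular velocity of `χᵖ`, so the feedback term alone drives `β`, and `c
= cos β` satisfies `c' = kθ (1 - c²)`. Since `β(0) ≠ π` excludes the equilibrium `c = -1`, `1 - c`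
decays exponentially. The velocity and the scaled field differ only by a planar rotation through
`β`, so their difference decays exponentially too.

For the path, take `V = k₁φ₁² + k₂φ₂²`. As `∇φ₁ × ∇φ₂` is orthogonal to both gradients, `V' ≤ -s G /
‖χ‖` up to an error `A (1 + V) exp (-κ t)`, where `G = ‖∑ kᵢ φᵢ ∇φᵢ‖²`. The difficulty is that `‖χ‖`
may be unbounded as `w` escapes, which weakens the dissipation. But `w` also slows down by the
factor `1 / ‖χ‖`: if `V` stayed away from `0`, the distance travelled by `w` would be controlled by
the total dissipation, so `w` and `‖χ‖` would be bounded and the dissipation would exhaust `V`. This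
is `tendsto_zero_of_dissipation`. -/

/-! ### Scalar differential inequalities. -/

/-- A function on `[0, ∞)` whose derivative is nonpositive from time `T` on is antitone there. -/
lemma antitoneOn_Ici_of_deriv_nonpos {F F' : ℝ → ℝ} {T : ℝ} (hT : 0 ≤ T)
    (hF : ∀ t, 0 ≤ t → HasDerivWithinAt F (F' t) (Ici 0) t)
    (h : ∀ t, T ≤ t → F' t ≤ 0) : AntitoneOn F (Ici T) := by
  have hsub : Ici T ⊆ Ici (0 : ℝ) := Ici_subset_Ici.2 hT
  refine antitoneOn_of_hasDerivWithinAt_nonpos (f' := F') (convex_Ici T)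
    (fun t ht => ((hF t (hsub ht)).continuousWithinAt).mono hsub) (fun t ht => ?_) (fun t ht => ?_)
  · have ht' := interior_subset ht
    exact (hF t (hsub ht')).mono (interior_subset.trans hsub)
  · exact h t (interior_subset ht)

/-- Solutions of the logistic equation `c' = κ (1 - c²)` in `(-1, 1]` converge to `1`
exponentially. -/
lemma one_sub_le_exp_of_logistic {c : ℝ → ℝ} {κ : ℝ} (hκ : 0 < κ)
    (hc : ∀ t, 0 ≤ t → HasDerivWithinAt c (κ * (1 - c t ^ 2)) (Ici 0) t)
    (hle : ∀ t, 0 ≤ t → |c t| ≤ 1) (h0 : -1 < c 0) :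
    ∃ r, 0 < r ∧ ∀ t, 0 ≤ t → 1 - c t ≤ 2 * exp (-(r * t)) := by
  have hsq : ∀ t, 0 ≤ t → c t ^ 2 ≤ 1 := fun t ht => (sq_le_one_iff_abs_le_one _).2 (hle t ht)
  have hmono : ∀ t, 0 ≤ t → c 0 ≤ c t := fun t ht => by
    have := antitoneOn_Ici_of_deriv_nonpos le_rfl (fun t ht => (hc t ht).neg)
      (fun t ht => by have := mul_nonneg hκ.le (sub_nonneg.2 (hsq t ht)); linarith)
      (mem_Ici.2 le_rfl) (mem_Ici.2 ht) ht
    simpa using this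
  -- As `c` increases, `1 - c² ≥ (1 - c) (1 + c 0)`, which gives this rate.
  refine ⟨κ * (1 + c 0), mul_pos hκ (by linarith), fun t ht => ?_⟩
  set r := κ * (1 + c 0) with hr
  have hd : ∀ t, 0 ≤ t → HasDerivWithinAt (fun t => (1 - c t) * exp (r * t))
      (-(κ * (1 - c t ^ 2)) * exp (r * t) + (1 - c t) * (exp (r * t) * r)) (Ici 0) t := by
    intro t ht
    have h1 : HasDerivWithinAt (fun t : ℝ => exp (r * t)) (exp (r * t) * r) (Ici 0) t := by
      simpa using (((hasDerivAt_id t).const_mul r).exp).hasDerivWithinAt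
    exact ((hc t ht).const_sub 1).mul h1
  have := antitoneOn_Ici_of_deriv_nonpos le_rfl hd (fun t ht => by
    have h1 : 0 ≤ 1 - c t := sub_nonneg.2 (abs_le.1 (hle t ht)).2
    have h2 := mul_nonneg (mul_nonneg (mul_nonneg hκ.le h1) (sub_nonneg.2 (hmono t ht)))
      (exp_pos (r * t)).le
    rw [hr] at h2 ⊢
    linarith) (mem_Ici.2 le_rfl) (mem_Ici.2 ht) ht
  simp only [mul_zero, exp_zero, mul_one] at this
  have h3 : 1 - c 0 ≤ 2 := by linarith
  have h4 : (1 - c t) = (1 - c t) * exp (r * t) * exp (-(r * t)) := by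
    rw [mul_assoc, ← exp_add]; simp
  rw [h4]
  exact mul_le_mul_of_nonneg_right (this.trans h3) (exp_pos _).le

/-- A Lyapunov argument for `V` with dissipation `G / N` under an exponentially decaying
perturbation. The dissipation may degenerate only where `N` is unbounded, that is where `w` is
unbounded, and `w` moves no faster than `(1 + √G) / N`. -/
lemma tendsto_zero_of_dissipation {V V' G N w w' : ℝ → ℝ} {s A κ c : ℝ}
    (hs : 0 < s) (hA : 0 ≤ A) (hκ : 0 < κ) (hc : 0 < c)
    (hV : ∀ t, 0 ≤ t → HasDerivWithinAt V (V' t) (Ici 0) t)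
    (hw : ∀ t, 0 ≤ t → HasDerivWithinAt w (w' t) (Ici 0) t)
    (hV0 : ∀ t, 0 ≤ t → 0 ≤ V t) (hN : ∀ t, 0 ≤ t → 0 < N t)
    (hV' : ∀ t, 0 ≤ t → V' t ≤ -(s * (G t / N t)) + A * (1 + V t) * exp (-(κ * t)))
    (hG : ∀ t, 0 ≤ t → c * V t ≤ G t)
    (hw' : ∀ t, 0 ≤ t → |w' t| ≤ s * ((1 + √(G t)) / N t))
    (hbdd : ∀ R M, ∃ B, ∀ t, 0 ≤ t → |w t| ≤ R → V t ≤ M → N t ≤ B) :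
    Tendsto V atTop (𝓝 0) := by
  -- The logarithm reduces the perturbation to `A exp (-κ t)`, which the derivative of the second
  -- term cancels.
  set W : ℝ → ℝ := fun t => log (1 + V t) + A / κ * exp (-(κ * t)) with hWdef
  set W' : ℝ → ℝ := fun t => V' t / (1 + V t) + A / κ * (exp (-(κ * t)) * -κ) with hW'def
  have hpos : ∀ t, 0 ≤ t → 0 < 1 + V t := fun t ht => by linarith [hV0 t ht]
  have hWd : ∀ t, 0 ≤ t → HasDerivWithinAt W (W' t) (Ici 0) t := by
    intro t ht
    have h1 : HasDerivWithinAt (fun t : ℝ => exp (-(κ * t))) (exp (-(κ * t)) * -κ) (Ici 0) t := by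
      simpa using (((hasDerivAt_id t).const_mul κ).neg.exp).hasDerivWithinAt
    exact (((hV t ht).const_add 1).log (hpos t ht).ne').add (h1.const_mul _)
  have hG0 : ∀ t, 0 ≤ t → 0 ≤ G t / N t := fun t ht =>
    div_nonneg ((mul_nonneg hc.le (hV0 t ht)).trans (hG t ht)) (hN t ht).le
  have hW'le : ∀ t, 0 ≤ t → W' t ≤ -(s * (G t / N t)) / (1 + V t) := by
    intro t ht
    have h1 := div_le_div_of_nonneg_right (hV' t ht) (hpos t ht).le
    have h2 : (-(s * (G t / N t)) + A * (1 + V t) * exp (-(κ * t))) / (1 + V t)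
        = -(s * (G t / N t)) / (1 + V t) + A * exp (-(κ * t)) := by
      have := (hpos t ht).ne'
      field_simp
    have h3 : A / κ * (exp (-(κ * t)) * -κ) = -(A * exp (-(κ * t))) := by
      field_simp
    simp only [hW'def]
    rw [h3]; linarith
  have hW'0 : ∀ t, 0 ≤ t → W' t ≤ 0 := fun t ht => (hW'le t ht).trans
    (div_nonpos_of_nonpos_of_nonneg (neg_nonpos.2 (mul_nonneg hs.le (hG0 t ht))) (hpos t ht).le)
  have hanti : AntitoneOn W (Ici 0) := antitoneOn_Ici_of_deriv_nonpos le_rfl hWd hW'0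
  have hexp0 : ∀ t, 0 ≤ A / κ * exp (-(κ * t)) := fun t =>
    mul_nonneg (div_nonneg hA hκ.le) (exp_pos _).le
  have hWnn : ∀ t, 0 ≤ t → 0 ≤ W t := fun t ht =>
    add_nonneg (log_nonneg (by linarith [hV0 t ht])) (hexp0 t)
  set M := exp (W 0) with hM
  have hMpos : 0 < M := exp_pos _
  have hVM : ∀ t, 0 ≤ t → 1 + V t ≤ M := fun t ht => by
    rw [← log_le_iff_le_exp (hpos t ht)]
    have := hanti (mem_Ici.2 le_rfl) (mem_Ici.2 ht) ht
    simp only [hWdef] at this ⊢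
    linarith [hexp0 t]
  have hW'M : ∀ t, 0 ≤ t → W' t ≤ -(s / M * (G t / N t)) := by
    intro t ht
    refine (hW'le t ht).trans ?_
    have h1 : s * (G t / N t) / M ≤ s * (G t / N t) / (1 + V t) :=
      div_le_div_of_nonneg_left (mul_nonneg hs.le (hG0 t ht)) (hpos t ht) (hVM t ht)
    rw [neg_div, div_mul_eq_mul_div]
    exact neg_le_neg h1
  -- convergence of `V`
  obtain ⟨l, hl⟩ : ∃ l, Tendsto W atTop (𝓝 l) := by
    -- Freezing time at `0` extends `W` to an antitone function on the whole line.
    have hanti' : Antitone fun t => W (max t 0) := fun a b hab =>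
      hanti (mem_Ici.2 (le_max_right _ _)) (mem_Ici.2 (le_max_right _ _))
        (max_le_max_right 0 hab)
    have := tendsto_atTop_ciInf hanti'
      ⟨0, by rintro _ ⟨t, rfl⟩; exact hWnn _ (le_max_right _ _)⟩
    refine ⟨_, this.congr' ?_⟩
    filter_upwards [eventually_ge_atTop 0] with t ht
    rw [max_eq_left ht]
  have hE : Tendsto (fun t => A / κ * exp (-(κ * t))) atTop (𝓝 0) := by
    have h1 : Tendsto (fun t : ℝ => exp (-(κ * t))) atTop (𝓝 0) :=
      tendsto_exp_neg_atTop_nhds_zero.comp (tendsto_id.const_mul_atTop hκ)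
    simpa using h1.const_mul (A / κ)
  have hVl : Tendsto V atTop (𝓝 (exp l - 1)) := by
    have h1 : Tendsto (fun t => exp (W t - A / κ * exp (-(κ * t))) - 1) atTop
        (𝓝 (exp (l - 0) - 1)) := ((hl.sub hE).rexp).sub_const 1
    rw [sub_zero] at h1
    refine h1.congr' ?_
    filter_upwards [eventually_ge_atTop 0] with t ht
    simp [hWdef, exp_log (hpos t ht)]
  have hlim : 0 ≤ exp l - 1 := ge_of_tendsto hVl
    ((eventually_ge_atTop 0).mono fun t ht => hV0 t ht)
  rcases hlim.eq_or_lt with h | h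
  · rwa [← h] at hVl
  exfalso
  obtain ⟨T₀, hT₀⟩ := eventually_atTop.1 (hVl.eventually (lt_mem_nhds (half_lt_self h)))
  set T := max T₀ 0
  have hT : 0 ≤ T := le_max_right _ _
  set γ := c * ((exp l - 1) / 2) with hγ
  have hγ0 : 0 < γ := mul_pos hc (half_pos h)
  have hGγ : ∀ t, T ≤ t → γ ≤ G t := fun t ht =>
    (mul_le_mul_of_nonneg_left (hT₀ t ((le_max_left _ _).trans ht)).le hc.le).trans
      (hG t (hT.trans ht))
  -- From `G ≥ γ` follow `1 ≤ G / γ` and `√G ≤ G / √γ`.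
  set K := 1 / γ + 1 / √γ with hK
  have hsγ : 0 < √γ := sqrt_pos.2 hγ0
  have hK0 : 0 < K := by positivity
  have hKG : ∀ t, T ≤ t → 1 + √(G t) ≤ K * G t := by
    intro t ht
    have h1 := hGγ t ht
    have h2 : √γ ≤ √(G t) := sqrt_le_sqrt h1
    have h3 : 1 ≤ 1 / γ * G t := by
      rw [div_mul_eq_mul_div, one_mul]; exact (one_le_div hγ0).2 h1
    have h4 : √(G t) ≤ 1 / √γ * G t := by
      rw [div_mul_eq_mul_div, one_mul, le_div_iff₀ hsγ]
      calc √(G t) * √γ ≤ √(G t) * √(G t) := mul_le_mul_of_nonneg_left h2 (sqrt_nonneg _)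
        _ = G t := mul_self_sqrt (hγ0.le.trans h1)
    rw [hK, add_mul]; linarith
  -- `w` is bounded
  have hww : ∀ t, T ≤ t → |w' t| ≤ K * M * -(W' t) := by
    intro t ht
    have ht0 := hT.trans ht
    calc |w' t| ≤ s * ((1 + √(G t)) / N t) := hw' t ht0
      _ ≤ s * ((K * G t) / N t) := by
        have := (hN t ht0).le
        gcongr
        exact hKG t ht
      _ = K * M * (s / M * (G t / N t)) := by field_simp
      _ ≤ K * M * -(W' t) := by
        have := hW'M t ht0
        have : 0 ≤ K * M := by positivity
        gcongr; linarith
  -- Both `K M W + w` and `K M W - w` decrease, and `W ≥ 0`.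
  have hwb : ∀ t, T ≤ t → |w t| ≤ |w T| + K * M * W T := by
    intro t ht
    have h1 := antitoneOn_Ici_of_deriv_nonpos hT
      (fun t ht => ((hWd t ht).const_mul (K * M)).add (hw t ht))
      (fun t ht => by have := (abs_le.1 (hww t ht)).2; linarith)
      (mem_Ici.2 le_rfl) (mem_Ici.2 ht) ht
    have h2 := antitoneOn_Ici_of_deriv_nonpos hT
      (fun t ht => ((hWd t ht).const_mul (K * M)).sub (hw t ht))
      (fun t ht => by have := (abs_le.1 (hww t ht)).1; linarith)
      (mem_Ici.2 le_rfl) (mem_Ici.2 ht) ht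
    have h3 : 0 ≤ K * M * W t := by have := hWnn t (hT.trans ht); positivity
    simp only [Pi.add_apply, Pi.sub_apply] at h1 h2
    rw [abs_le]
    constructor <;> linarith [le_abs_self (w T), neg_abs_le (w T)]
  obtain ⟨B, hB⟩ := hbdd (|w T| + K * M * W T) M
  have hNB : ∀ t, T ≤ t → N t ≤ B := fun t ht =>
    hB t (hT.trans ht) (hwb t ht) (by linarith [hVM t (hT.trans ht)])
  have hBpos : 0 < B := (hN T hT).trans_le (hNB T le_rfl)
  set δ := s / M * (γ / B) with hδ
  have hδ0 : 0 < δ := by positivity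
  have hdec : ∀ t, T ≤ t → W t + δ * t ≤ W T + δ * T := by
    intro t ht
    exact antitoneOn_Ici_of_deriv_nonpos hT
      (fun t ht => (hWd t ht).add (((hasDerivAt_id t).const_mul δ).hasDerivWithinAt))
      (fun t ht => by
        have h1 := hW'M t (hT.trans ht)
        have h2 : δ ≤ s / M * (G t / N t) := by
          have := hN t (hT.trans ht)
          have := hNB t ht
          have := hγ0.le.trans (hGγ t ht)
          rw [hδ]; gcongr; exact hGγ t ht
        linarith) (mem_Ici.2 le_rfl) (mem_Ici.2 ht) ht
  -- By this time `W`, decreasing at rate at least `δ`, would have reached `-1`.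
  have h5 := hdec (T + (W T + 1) / δ)
    (le_add_of_nonneg_right (div_nonneg (by linarith [hWnn T hT]) hδ0.le))
  have h6 := hWnn (T + (W T + 1) / δ)
    (hT.trans (le_add_of_nonneg_right (div_nonneg (by linarith [hWnn T hT]) hδ0.le)))
  have h7 : δ * ((W T + 1) / δ) = W T + 1 := mul_div_cancel₀ _ hδ0.ne'
  rw [mul_add, h7] at h5
  linarith

/-! ### The field in coordinates and its regularity. -/

variable {f : Fin 2 → ℝ → ℝ} {k : Fin 2 → ℝ}

lemma gradient_surface (hf : ∀ i, Differentiable ℝ (f i)) (p : E3) :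
    ∇ (surface f 0) p = !₂[1, 0, -deriv (f 0) (p 2)] ∧
    ∇ (surface f 1) p = !₂[0, 1, -deriv (f 1) (p 2)] := by
  have hproj : ∀ j : Fin 3, HasFDerivAt (fun p : E3 => p j)
      (EuclideanSpace.proj j : E3 →L[ℝ] ℝ) p := fun j =>
    (EuclideanSpace.proj j : E3 →L[ℝ] ℝ).hasFDerivAt
  have h : ∀ i : Fin 2, HasFDerivAt (surface f i)
      ((EuclideanSpace.proj i.castSucc : E3 →L[ℝ] ℝ) -
        deriv (f i) (p 2) • (EuclideanSpace.proj 2 : E3 →L[ℝ] ℝ)) p := fun i =>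
    (hproj _).sub ((hf i (p 2)).hasDerivAt.comp_hasFDerivAt p (hproj 2))
  constructor
  all_goals
    refine HasGradientAt.gradient (hasGradientAt_iff_hasFDerivAt.2 ?_)
  · refine (h 0).congr_fderiv (ContinuousLinearMap.ext fun v => ?_)
    rw [InnerProductSpace.toDual_apply_apply]
    simp [PiLp.inner_apply, Fin.sum_univ_three]
    ring
  · refine (h 1).congr_fderiv (ContinuousLinearMap.ext fun v => ?_)
    rw [InnerProductSpace.toDual_apply_apply]
    simp [PiLp.inner_apply, Fin.sum_univ_three]
    ring

lemma field_eq (hf : ∀ i, Differentiable ℝ (f i)) (k : Fin 2 → ℝ) (p : E3) :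
    field f k p = !₂[deriv (f 0) (p 2) - k 0 * surface f 0 p,
      deriv (f 1) (p 2) - k 1 * surface f 1 p,
      1 + k 0 * surface f 0 p * deriv (f 0) (p 2) + k 1 * surface f 1 p * deriv (f 1) (p 2)] := by
  obtain ⟨h0, h1⟩ := gradient_surface hf p
  ext j
  fin_cases j <;>
    simp [field, guidingField, cross, h0, h1, cross_apply, Fin.sum_univ_two]
  ring

lemma differentiable_field (hf : ∀ i, ContDiff ℝ 2 (f i)) (k : Fin 2 → ℝ) :
    Differentiable ℝ (field f k) := by
  have hd : ∀ i, Differentiable ℝ (f i) := fun i => (hf i).differentiable (by norm_num)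
  have hd' : ∀ i, Differentiable ℝ (deriv (f i)) := fun i =>
    ((contDiff_succ_iff_deriv (n := 1)).1 (by simpa [one_add_one_eq_two] using hf i)).2.2.differentiable (by norm_num)
  have hc : ∀ j : Fin 3, Differentiable ℝ fun p : E3 => p j := fun j =>
    (EuclideanSpace.proj j : E3 →L[ℝ] ℝ).differentiable
  have hs : ∀ i, Differentiable ℝ (surface f i) := fun i =>
    (hc _).sub ((hd i).comp (hc 2))
  have h' : ∀ i, Differentiable ℝ fun p : E3 => deriv (f i) (p 2) := fun i =>
    (hd' i).comp (hc 2)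
  rw [differentiable_euclidean]
  intro j
  simp_rw [field_eq hd k]
  fin_cases j
  · exact (h' 0).sub ((hs 0).const_mul _)
  · exact (h' 1).sub ((hs 1).const_mul _)
  · exact ((((hs 0).const_mul _).mul (h' 0)).const_add 1).add (((hs 1).const_mul _).mul (h' 1))

lemma fieldHat_apply (p : E3) (j : Fin 3) :
    fieldHat f k p j = field f k p j / ‖field f k p‖ := by
  simp [fieldHat, NormedSpace.normalize, div_eq_inv_mul]

lemma norm_sq_E2 (v : E2) : ‖v‖ ^ 2 = v 0 ^ 2 + v 1 ^ 2 := by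
  simp [EuclideanSpace.norm_sq_eq, Fin.sum_univ_two]

lemma norm_sq_E3 (v : E3) : ‖v‖ ^ 2 = v 0 ^ 2 + v 1 ^ 2 + v 2 ^ 2 := by
  simp [EuclideanSpace.norm_sq_eq, Fin.sum_univ_three]

lemma differentiableAt_planarField (hf : ∀ i, ContDiff ℝ 2 (f i)) {p : E3}
    (hp : field f k p ≠ 0) : DifferentiableAt ℝ (planarField f k) p := by
  have h1 : DifferentiableAt ℝ (fieldHat f k) p :=
    (((differentiable_field hf k p).norm ℝ hp).inv (norm_ne_zero_iff.2 hp)).smul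
      (differentiable_field hf k p)
  have h2 := differentiableAt_euclidean.1 h1
  rw [differentiableAt_euclidean]
  intro i
  fin_cases i
  · exact h2 0
  · exact h2 1

/-! ### The heading error. -/

lemma norm_heading (θ : ℝ) : ‖heading θ‖ = 1 := by
  rw [← sq_eq_sq₀ (norm_nonneg _) zero_le_one, norm_sq_E2]
  simp [heading]

lemma normalize_heading (θ : ℝ) : NormedSpace.normalize (heading θ) = heading θ :=
  NormedSpace.normalize_eq_self_of_norm_eq_one (norm_heading θ)

lemma normalize_apply_E2 (v : E2) (i : Fin 2) : NormedSpace.normalize v i = v i / ‖v‖ := by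
  simp [NormedSpace.normalize, div_eq_inv_mul]

lemma rotE_apply (v : E2) : rotE v = !₂[-v 1, v 0] := by
  ext i
  fin_cases i <;>
    simp [rotE, Matrix.toLpLin_apply, dotProduct, Fin.sum_univ_two]

/-- The cosine of the angle between `u` and the heading `(cos θ, sin θ)`. -/
noncomputable def cosError (u : E2) (θ : ℝ) : ℝ := (u 0 * cos θ + u 1 * sin θ) / ‖u‖

/-- The sine of the angle directed from `u` to the heading `(cos θ, sin θ)`. -/
noncomputable def sinError (u : E2) (θ : ℝ) : ℝ := (u 0 * sin θ - u 1 * cos θ) / ‖u‖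

lemma headingError_eq_arg (p : E3) (θ : ℝ) : headingError f k p θ =
    Complex.arg ⟨cosError (planarField f k p) θ, sinError (planarField f k p) θ⟩ := by
  rw [headingError, directedAngle, normalize_heading]
  simp only [planarFieldHat, normalize_apply_E2, cosError, sinError, heading]
  congr 2 <;> simp <;> ring

lemma cosError_sq_add_sinError_sq {u : E2} (hu : u ≠ 0) (θ : ℝ) :
    cosError u θ ^ 2 + sinError u θ ^ 2 = 1 := by
  have h := norm_sq_E2 u
  have hn : ‖u‖ ^ 2 ≠ 0 := pow_ne_zero 2 (norm_ne_zero_iff.2 hu)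
  rw [cosError, sinError, div_pow, div_pow, ← add_div, div_eq_one_iff_eq hn, h]
  linear_combination (u 0 ^ 2 + u 1 ^ 2) * sin_sq_add_cos_sq θ

/-- A cosine of `-1` forces the sine to vanish, and then the argument is `π`. -/
lemma neg_one_lt_cosError {p : E3} {θ : ℝ} (hu : planarField f k p ≠ 0)
    (h : headingError f k p θ ∈ Ioo (-π) π) : -1 < cosError (planarField f k p) θ := by
  have h1 := cosError_sq_add_sinError_sq hu θ
  have hle : -1 ≤ cosError (planarField f k p) θ := by
    nlinarith [sq_nonneg (sinError (planarField f k p) θ)]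
  refine lt_of_le_of_ne hle fun hc => ?_
  have hs : sinError (planarField f k p) θ = 0 := by
    rw [← hc] at h1
    nlinarith
  rw [headingError_eq_arg, ← hc, hs] at h
  have : (⟨-1, 0⟩ : ℂ) = -1 := by apply Complex.ext <;> simp
  rw [this, Complex.arg_neg_one] at h
  exact lt_irrefl _ h.2

/-- If the heading turns at the rate of `u` minus `κ` times the sine of the error, then the cosine
of the error satisfies the logistic equation. -/
lemma hasDerivWithinAt_cosError {u : ℝ → E2} {u' : E2} {θ : ℝ → ℝ} {κ t : ℝ} {S : Set ℝ}
    (hu : HasDerivWithinAt u u' S t) (h0 : u t ≠ 0)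
    (hθ : HasDerivWithinAt θ ((u t 0 * u' 1 - u t 1 * u' 0) / ‖u t‖ ^ 2
      - κ * sinError (u t) (θ t)) S t) :
    HasDerivWithinAt (fun t => cosError (u t) (θ t))
      (κ * (1 - cosError (u t) (θ t) ^ 2)) S t := by
  have hc : ∀ i : Fin 2, HasDerivWithinAt (fun t => u t i) (u' i) S t := fun i =>
    (EuclideanSpace.proj i : E2 →L[ℝ] ℝ).hasFDerivAt.comp_hasDerivWithinAt t hu
  have hnorm : ∀ v : E2, ‖v‖ = √(v 0 ^ 2 + v 1 ^ 2) := fun v => by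
    rw [← norm_sq_E2, sqrt_sq (norm_nonneg v)]
  have hpos : 0 < ‖u t‖ := norm_pos_iff.2 h0
  have hsq := norm_sq_E2 (u t)
  have hn : HasDerivWithinAt (fun t => ‖u t‖)
      ((2 * u t 0 * u' 0 + 2 * u t 1 * u' 1) / (2 * ‖u t‖)) S t := by
    simp_rw [hnorm]
    have h1 := (((hc 0).pow 2).add ((hc 1).pow 2)).sqrt
      (show u t 0 ^ 2 + u t 1 ^ 2 ≠ 0 by rw [← hsq]; positivity)
    simpa using h1
  have h := (((hc 0).mul hθ.cos).add ((hc 1).mul hθ.sin)).div hn hpos.ne'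
  refine h.congr_deriv ?_
  -- The cosine's derivative is minus the sine times the relative turning rate `-κ sin`, hence `κ
  -- sin²`.
  have h1 : 1 - cosError (u t) (θ t) ^ 2 = sinError (u t) (θ t) ^ 2 := by
    linarith [cosError_sq_add_sinError_sq h0 (θ t)]
  rw [h1]
  simp only [sinError, Pi.add_apply, Pi.mul_apply]
  generalize ‖u t‖ = n at *
  generalize u t 0 = a at *
  generalize u t 1 = b at *
  field_simp
  have hb : b ^ 2 = n ^ 2 - a ^ 2 := by linarith
  ring_nf
  simp only [hb]
  ring

/-- The right side is the angular velocity of `χᵖ` along `v`, as `hasDerivWithinAt_cosError`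
requires it. -/
lemma desiredRate_eq (p v : E3) : desiredRate f k p v =
    (planarField f k p 0 * (fderiv ℝ (planarField f k) p v) 1
      - planarField f k p 1 * (fderiv ℝ (planarField f k) p v) 0) / ‖planarField f k p‖ ^ 2 := by
  simp only [desiredRate, rotE_apply, planarFieldHat]
  simp [PiLp.inner_apply, Fin.sum_univ_two, normalize_apply_E2]
  rcases eq_or_ne ‖planarField f k p‖ 0 with h | h
  · simp [h]
  · field_simp
    ring

lemma inner_heading_rotE (p : E3) (θ : ℝ) :
    inner ℝ (NormedSpace.normalize (heading θ)) (rotE (planarFieldHat f k p))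
      = sinError (planarField f k p) θ := by
  rw [normalize_heading, rotE_apply]
  simp [PiLp.inner_apply, Fin.sum_univ_two, planarFieldHat, normalize_apply_E2, heading, sinError]
  ring

lemma planarField_apply (p : E3) :
    planarField f k p 0 = fieldHat f k p 0 ∧ planarField f k p 1 = fieldHat f k p 1 := by
  simp [planarField]

lemma planarField_ne_zero {p : E3} (h : field f k p 0 ^ 2 + field f k p 1 ^ 2 ≠ 0) :
    field f k p ≠ 0 ∧ planarField f k p ≠ 0 := by
  have h1 : field f k p ≠ 0 := fun h1 => h (by simp [h1])
  refine ⟨h1, fun h2 => h ?_⟩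
  have hn := norm_ne_zero_iff.2 h1
  have h3 := (planarField_apply (f := f) (k := k) p).1
  have h4 := (planarField_apply (f := f) (k := k) p).2
  rw [h2, fieldHat_apply, PiLp.zero_apply, eq_comm, div_eq_zero_iff, or_iff_left hn] at h3 h4
  simp [h3, h4]

lemma norm_planarField_le_one (p : E3) : ‖planarField f k p‖ ≤ 1 := by
  have h1 : ‖fieldHat f k p‖ ≤ 1 := by
    rcases eq_or_ne (field f k p) 0 with h | h
    · simp [fieldHat, h]
    · exact (NormedSpace.norm_normalize_eq_one_iff.2 h).le
  refine le_trans ?_ h1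
  rw [← sq_le_sq₀ (norm_nonneg _) (norm_nonneg _), norm_sq_E2, norm_sq_E3,
    (planarField_apply p).1, (planarField_apply p).2]
  linarith [sq_nonneg (fieldHat f k p 2)]

/-- The generalized velocity differs from the scaled field by at most a multiple of the chord of
the heading error. -/
lemma norm_sub_smul_fieldHat_sq_le {s θ : ℝ} {p v : E3} (h : planarField f k p ≠ 0)
    (h0 : v 0 = speedInput f k s p * cos θ) (h1 : v 1 = speedInput f k s p * sin θ)
    (h2 : v 2 = s * fieldHat f k p 2) :
    ‖v - s • fieldHat f k p‖ ^ 2 ≤ 2 * s ^ 2 * (1 - cosError (planarField f k p) θ) := by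
  have hn : ‖planarField f k p‖ ≠ 0 := norm_ne_zero_iff.2 h
  have hc : cosError (planarField f k p) θ ≤ 1 := by
    nlinarith [cosError_sq_add_sinError_sq h θ, sq_nonneg (sinError (planarField f k p) θ)]
  have hle : ‖planarField f k p‖ ^ 2 ≤ 1 :=
    pow_le_one₀ (norm_nonneg _) (norm_planarField_le_one p)
  have hsq := norm_sq_E2 (planarField f k p)
  -- The third entries agree and both planar parts have length `s ‖χᵖ‖`, so this is the law of
  -- cosines.
  have heq : ‖v - s • fieldHat f k p‖ ^ 2 = ‖planarField f k p‖ ^ 2 *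
      (2 * s ^ 2 * (1 - cosError (planarField f k p) θ)) := by
    rw [norm_sq_E3, cosError]
    simp only [PiLp.sub_apply, PiLp.smul_apply, smul_eq_mul, h0, h1, h2, speedInput,
      ← (planarField_apply (f := f) (k := k) p).1, ← (planarField_apply (f := f) (k := k) p).2]
    generalize ‖planarField f k p‖ = n at *
    field_simp
    linear_combination s ^ 2 * n ^ 2 * sin_sq_add_cos_sq θ - s ^ 2 * hsq
  rw [heq]
  exact mul_le_of_le_one_left (mul_nonneg (by positivity) (by linarith)) hle

lemma tendsto_headingError {u : ℝ → E2} {θ : ℝ → ℝ} (hu : ∀ t, 0 ≤ t → u t ≠ 0)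
    (hc : Tendsto (fun t => cosError (u t) (θ t)) atTop (𝓝 1)) :
    Tendsto (fun t => Complex.arg ⟨cosError (u t) (θ t), sinError (u t) (θ t)⟩) atTop (𝓝 0) := by
  have hs : Tendsto (fun t => sinError (u t) (θ t)) atTop (𝓝 0) := by
    have h1 : Tendsto (fun t => √(1 - cosError (u t) (θ t) ^ 2)) atTop (𝓝 0) := by
      simpa using ((hc.pow 2).const_sub 1).sqrt
    refine (tendsto_zero_iff_abs_tendsto_zero _).2 (h1.congr' ?_)
    filter_upwards [eventually_ge_atTop 0] with t ht
    rw [Function.comp_apply, ← sqrt_sq_eq_abs]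
    congr 1
    linarith [cosError_sq_add_sinError_sq (hu t ht) (θ t)]
  have h1 : Tendsto (fun t => (⟨cosError (u t) (θ t), sinError (u t) (θ t)⟩ : ℂ)) atTop
      (𝓝 1) := by
    simp_rw [Complex.mk_eq_add_mul_I]
    simpa using ((Complex.continuous_ofReal.tendsto _).comp hc).add
      (((Complex.continuous_ofReal.tendsto _).comp hs).mul_const Complex.I)
  have h2 := (Complex.continuousAt_arg Complex.one_mem_slitPlane).tendsto.comp h1
  rwa [Complex.arg_one] at h2

/-! ### The path error as a Lyapunov function. -/

/-- The weighted sum of squares of the surface functions. -/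
noncomputable def pathError (f : Fin 2 → ℝ → ℝ) (k : Fin 2 → ℝ) (p : E3) : ℝ :=
  k 0 * surface f 0 p ^ 2 + k 1 * surface f 1 p ^ 2

/-- The squared norm of the converging part `∑ i, k i * φ i * ∇φ i` of the field. -/
noncomputable def gainSq (f : Fin 2 → ℝ → ℝ) (k : Fin 2 → ℝ) (p : E3) : ℝ :=
  (k 0 * surface f 0 p) ^ 2 + (k 1 * surface f 1 p) ^ 2 +
    (k 0 * surface f 0 p * deriv (f 0) (p 2) + k 1 * surface f 1 p * deriv (f 1) (p 2)) ^ 2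

lemma hasDerivWithinAt_surface (hf : ∀ i, Differentiable ℝ (f i)) (i : Fin 2) {p : ℝ → E3}
    {v : E3} {t : ℝ} {S : Set ℝ} (hp : HasDerivWithinAt p v S t) :
    HasDerivWithinAt (fun t => surface f i (p t))
      (v i.castSucc - deriv (f i) (p t 2) * v 2) S t := by
  have hc : ∀ j : Fin 3, HasDerivWithinAt (fun t => p t j) (v j) S t := fun j =>
    (EuclideanSpace.proj j : E3 →L[ℝ] ℝ).hasFDerivAt.comp_hasDerivWithinAt t hp
  exact (hc _).sub ((hf i (p t 2)).hasDerivAt.comp_hasDerivWithinAt t (hc 2))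

/-- Since `|x| ≤ 1 + x²`, a perturbation linear in `φ` is bounded by a multiple of `1 + V`. -/
lemma abs_gain_le (hk : ∀ i, 0 < k i) (p : E3) :
    |k 0 * surface f 0 p| ≤ k 0 + pathError f k p ∧
    |k 1 * surface f 1 p| ≤ k 1 + pathError f k p := by
  have h : ∀ i, |k i * surface f i p| ≤ k i + k i * surface f i p ^ 2 := fun i => by
    rw [abs_mul, abs_of_pos (hk i), ← sq_abs]
    nlinarith [hk i, mul_nonneg (hk i).le (sq_nonneg (|surface f i p| - 1)),
      mul_nonneg (hk i).le (abs_nonneg (surface f i p))]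
  have h0 := mul_nonneg (hk 0).le (sq_nonneg (surface f 0 p))
  have h1 := mul_nonneg (hk 1).le (sq_nonneg (surface f 1 p))
  exact ⟨(h 0).trans (by rw [pathError]; linarith), (h 1).trans (by rw [pathError]; linarith)⟩

/-- The decay of the path error along a velocity `v` close to the scaled normalized field. -/
lemma deriv_pathError_le (hf : ∀ i, Differentiable ℝ (f i)) (hk : ∀ i, 0 < k i) {s δ : ℝ}
    (hs : 0 < s) {p v : E3} (h2 : v 2 = s * fieldHat f k p 2)
    (hv : ‖v - s • fieldHat f k p‖ ≤ δ) :
    2 * (k 0 * surface f 0 p * (v 0 - deriv (f 0) (p 2) * v 2) +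
      k 1 * surface f 1 p * (v 1 - deriv (f 1) (p 2) * v 2)) ≤
    -(s * (gainSq f k p / ‖field f k p‖)) +
      2 * (k 0 + k 1 + 2) * δ * (1 + pathError f k p) := by
  have hδ : 0 ≤ δ := (norm_nonneg _).trans hv
  have hG : 0 ≤ s * (gainSq f k p / ‖field f k p‖) := by rw [gainSq]; positivity
  have hV : 0 ≤ pathError f k p := by
    have := (hk 0).le; have := (hk 1).le; rw [pathError]; positivity
  have hd : ∀ j : Fin 3, |v j - s * fieldHat f k p j| ≤ δ := fun j => by
    simpa using (PiLp.norm_apply_le (v - s • fieldHat f k p) j).trans hv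
  have hb : ∀ i : Fin 2, ∀ j : Fin 3, |k i * surface f i p| ≤ k i + pathError f k p →
      k i * surface f i p * (v j - s * fieldHat f k p j) ≤ (k i + pathError f k p) * δ :=
    fun i j hi => (le_abs_self _).trans (by
      rw [abs_mul]; exact mul_le_mul hi (hd j) (abs_nonneg _) (by linarith [hk i]))
  have hb0 := hb 0 0 (abs_gain_le hk p).1
  have hb1 := hb 1 1 (abs_gain_le hk p).2
  -- The cross product part of the field drops out by orthogonality; half of the resulting
  -- dissipation is discarded at the end.
  have heq : 2 * (k 0 * surface f 0 p * (v 0 - deriv (f 0) (p 2) * v 2) +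
      k 1 * surface f 1 p * (v 1 - deriv (f 1) (p 2) * v 2)) =
      -2 * (s * (gainSq f k p / ‖field f k p‖)) +
      2 * (k 0 * surface f 0 p * (v 0 - s * fieldHat f k p 0) +
        k 1 * surface f 1 p * (v 1 - s * fieldHat f k p 1)) := by
    rw [h2]
    simp only [fieldHat_apply, div_eq_mul_inv]
    generalize ‖field f k p‖⁻¹ = q
    rw [field_eq hf k p, gainSq]
    simp only [Matrix.cons_val_zero, Matrix.cons_val_one, Matrix.cons_val]
    ring
  have hδk : 0 ≤ (k 0 + k 1) * δ * pathError f k p := by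
    have := (hk 0).le; have := (hk 1).le; positivity
  rw [heq]
  nlinarith [hδk, hδ, hG, hb0, hb1]

lemma min_mul_pathError_le_gainSq (p : E3) (hk : ∀ i, 0 < k i) :
    min (k 0) (k 1) * pathError f k p ≤ gainSq f k p := by
  have h0 : min (k 0) (k 1) * (k 0 * surface f 0 p ^ 2) ≤ k 0 * (k 0 * surface f 0 p ^ 2) :=
    mul_le_mul_of_nonneg_right (min_le_left _ _) (mul_nonneg (hk 0).le (sq_nonneg _))
  have h1 : min (k 0) (k 1) * (k 1 * surface f 1 p ^ 2) ≤ k 1 * (k 1 * surface f 1 p ^ 2) :=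
    mul_le_mul_of_nonneg_right (min_le_right _ _) (mul_nonneg (hk 1).le (sq_nonneg _))
  have h2 := sq_nonneg (k 0 * surface f 0 p * deriv (f 0) (p 2) +
    k 1 * surface f 1 p * deriv (f 1) (p 2))
  rw [pathError, gainSq]
  linarith

/-- The `1` is the third entry of `∇φ₁ × ∇φ₂`; the square of the remaining term is a summand of
`gainSq`. -/
lemma abs_fieldHat_two_le (hf : ∀ i, Differentiable ℝ (f i)) (p : E3) :
    |fieldHat f k p 2| ≤ (1 + √(gainSq f k p)) / ‖field f k p‖ := by
  rw [fieldHat_apply, abs_div, abs_norm]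
  refine div_le_div_of_nonneg_right ?_ (norm_nonneg _)
  have h : |k 0 * surface f 0 p * deriv (f 0) (p 2) + k 1 * surface f 1 p * deriv (f 1) (p 2)|
      ≤ √(gainSq f k p) := abs_le_sqrt (by
    rw [gainSq]; linarith [sq_nonneg (k 0 * surface f 0 p), sq_nonneg (k 1 * surface f 1 p)])
  rw [field_eq hf k p]
  simp only [Matrix.cons_val, add_assoc]
  exact (abs_add_le _ _).trans (by rw [abs_one]; linarith)

/-- The field is bounded where the path parameter and the path error are. -/
lemma exists_norm_field_le (hf : ∀ i, ContDiff ℝ 2 (f i)) (hk : ∀ i, 0 < k i) (R M : ℝ) :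
    ∃ B, ∀ p : E3, |p 2| ≤ R → pathError f k p ≤ M → ‖field f k p‖ ≤ B := by
  have hd : ∀ i, Differentiable ℝ (f i) := fun i => (hf i).differentiable (by norm_num)
  have hD : ∀ i, ∃ D, ∀ w ∈ Icc (-R) R, ‖deriv (f i) w‖ ≤ D := fun i =>
    isCompact_Icc.exists_bound_of_continuousOn ((hf i).continuous_deriv (by norm_num)).continuousOn
  obtain ⟨D0, hD0⟩ := hD 0
  obtain ⟨D1, hD1⟩ := hD 1
  refine ⟨(D0 + (k 0 + M)) + (D1 + (k 1 + M)) + (1 + (k 0 + M) * D0 + (k 1 + M) * D1),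
    fun p hR hM => ?_⟩
  have ha : |deriv (f 0) (p 2)| ≤ D0 := hD0 _ (abs_le.1 hR)
  have hb : |deriv (f 1) (p 2)| ≤ D1 := hD1 _ (abs_le.1 hR)
  have h0 : |k 0 * surface f 0 p| ≤ k 0 + M := (abs_gain_le hk p).1.trans (by linarith)
  have h1 : |k 1 * surface f 1 p| ≤ k 1 + M := (abs_gain_le hk p).2.trans (by linarith)
  have hsum : ∀ v : E3, ‖v‖ ≤ |v 0| + |v 1| + |v 2| := fun v => by
    rw [← sq_le_sq₀ (norm_nonneg _) (by positivity), norm_sq_E3, ← sq_abs (v 0), ← sq_abs (v 1),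
      ← sq_abs (v 2)]
    nlinarith [mul_nonneg (abs_nonneg (v 0)) (abs_nonneg (v 1)),
      mul_nonneg (abs_nonneg (v 0)) (abs_nonneg (v 2)),
      mul_nonneg (abs_nonneg (v 1)) (abs_nonneg (v 2))]
  refine (hsum _).trans ?_
  rw [field_eq hd k p]
  simp only [Matrix.cons_val_zero, Matrix.cons_val_one, Matrix.cons_val]
  have hm : ∀ {x y X Y : ℝ}, |x| ≤ X → |y| ≤ Y → |x * y| ≤ X * Y := fun hx hy => by
    rw [abs_mul]; exact mul_le_mul hx hy (abs_nonneg _) ((abs_nonneg _).trans hx)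
  refine add_le_add (add_le_add ((abs_sub _ _).trans (add_le_add ha h0))
    ((abs_sub _ _).trans (add_le_add hb h1))) ?_
  exact (abs_add_le _ _).trans (add_le_add ((abs_add_le _ _).trans
    (add_le_add abs_one.le (hm h0 ha))) (hm h1 hb))

/-- Compare with the path point of the same parameter `w`. -/
lemma infDist_physicalPath_le (hk : ∀ i, 0 < k i) (p : E3) :
    Metric.infDist (!₂[p 0, p 1] : E2) (physicalPath f) ≤
      √(pathError f k p / min (k 0) (k 1)) := by
  refine (Metric.infDist_le_dist_of_mem (Set.mem_range_self (p 2))).trans (le_sqrt_of_sq_le ?_)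
  have hm : 0 < min (k 0) (k 1) := lt_min (hk 0) (hk 1)
  rw [dist_eq_norm, norm_sq_E2, le_div_iff₀ hm]
  have h0 : surface f 0 p ^ 2 * min (k 0) (k 1) ≤ surface f 0 p ^ 2 * k 0 :=
    mul_le_mul_of_nonneg_left (min_le_left _ _) (sq_nonneg _)
  have h1 : surface f 1 p ^ 2 * min (k 0) (k 1) ≤ surface f 1 p ^ 2 * k 1 :=
    mul_le_mul_of_nonneg_left (min_le_right _ _) (sq_nonneg _)
  simp only [surface, Fin.castSucc_zero, Fin.castSucc_one] at h0 h1
  simp only [pathError, surface, Fin.castSucc_zero, Fin.castSucc_one]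
  simp
  linarith

lemma tendsto_exp_neg_mul {r : ℝ} (hr : 0 < r) :
    Tendsto (fun t : ℝ => exp (-(r * t))) atTop (𝓝 0) :=
  tendsto_exp_neg_atTop_nhds_zero.comp (tendsto_id.const_mul_atTop hr)

end UnicycleVF

/-! ### The closed loop. -/

open UnicycleVF in
theorem mainTheorem2 (f : Fin 2 → ℝ → ℝ) (hf : ∀ i, ContDiff ℝ 2 (f i))
    (k : Fin 2 → ℝ) (hk : ∀ i, 0 < k i) (s kθ : ℝ) (hs : 0 < s) (hkθ : 0 < kθ)
    (p pdot : ℝ → UnicycleVF.E3) (θ : ℝ → ℝ)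
    (htraj : UnicycleVF.IsClosedLoop f k s kθ p pdot θ)
    (hreg : ∀ t : ℝ, 0 ≤ t →
      UnicycleVF.field f k (p t) 0 ^ 2 + UnicycleVF.field f k (p t) 1 ^ 2 ≠ 0)
    (hβ : UnicycleVF.headingError f k (p 0) (θ 0) ∈ Set.Ioo (-Real.pi) Real.pi) :
    Tendsto (fun t => UnicycleVF.headingError f k (p t) (θ t)) atTop (𝓝 0) ∧
    Tendsto (fun t => pdot t - s • UnicycleVF.fieldHat f k (p t)) atTop (𝓝 0) ∧
    Tendsto (fun t => Metric.infDist (!₂[p t 0, p t 1] : UnicycleVF.E2)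
      (UnicycleVF.physicalPath f)) atTop (𝓝 0) := by
  have hd : ∀ i, Differentiable ℝ (f i) := fun i => (hf i).differentiable (by norm_num)
  have hχ : ∀ t, 0 ≤ t → field f k (p t) ≠ 0 := fun t ht => (planarField_ne_zero (hreg t ht)).1
  have hu : ∀ t, 0 ≤ t → planarField f k (p t) ≠ 0 := fun t ht =>
    (planarField_ne_zero (hreg t ht)).2
  have hcd : ∀ t, 0 ≤ t → HasDerivWithinAt (fun t => cosError (planarField f k (p t)) (θ t))
      (kθ * (1 - cosError (planarField f k (p t)) (θ t) ^ 2)) (Ici 0) t := by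
    intro t ht
    refine hasDerivWithinAt_cosError (u := fun t => planarField f k (p t))
      ((differentiableAt_planarField hf (hχ t ht)).hasFDerivAt.comp_hasDerivWithinAt t
        (htraj.velocity t ht)) (hu t ht) ?_
    have h := htraj.θ_eq t ht
    rwa [angularInput, inner_heading_rotE, desiredRate_eq] at h
  obtain ⟨r, hr, hexp⟩ := one_sub_le_exp_of_logistic hkθ hcd
    (fun t ht => (sq_le_one_iff_abs_le_one _).1 (by
      linarith [cosError_sq_add_sinError_sq (hu t ht) (θ t),
        sq_nonneg (sinError (planarField f k (p t)) (θ t))]))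
    (neg_one_lt_cosError (hu 0 le_rfl) hβ)
  -- The squared velocity error is bounded by a multiple of `1 - cos β`, so the square root halves
  -- the rate.
  have hvel : ∀ t, 0 ≤ t →
      ‖pdot t - s • fieldHat f k (p t)‖ ≤ 2 * s * exp (-(r / 2 * t)) := by
    intro t ht
    rw [← sq_le_sq₀ (norm_nonneg _) (by positivity)]
    refine (norm_sub_smul_fieldHat_sq_le (hu t ht) (htraj.x_eq t ht) (htraj.y_eq t ht)
      (htraj.w_eq t ht)).trans ?_
    have h1 : (2 * s * exp (-(r / 2 * t))) ^ 2 = 2 * s ^ 2 * (2 * exp (-(r * t))) := by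
      rw [mul_pow, ← exp_nat_mul]
      ring_nf
    rw [h1]
    exact mul_le_mul_of_nonneg_left (hexp t ht) (by positivity)
  refine ⟨?_, ?_, ?_⟩
  · simp_rw [headingError_eq_arg]
    refine tendsto_headingError hu ?_
    have h1 : Tendsto (fun t => 1 - 2 * exp (-(r * t))) atTop (𝓝 1) := by
      simpa using ((tendsto_exp_neg_mul hr).const_mul 2).const_sub 1
    refine tendsto_of_tendsto_of_tendsto_of_le_of_le' h1 tendsto_const_nhds ?_ ?_
    · filter_upwards [eventually_ge_atTop 0] with t ht
      linarith [hexp t ht]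
    · filter_upwards [eventually_ge_atTop 0] with t ht
      nlinarith [cosError_sq_add_sinError_sq (hu t ht) (θ t),
        sq_nonneg (sinError (planarField f k (p t)) (θ t))]
  · refine squeeze_zero_norm' ((eventually_ge_atTop 0).mono hvel) ?_
    simpa using (tendsto_exp_neg_mul (half_pos hr)).const_mul (2 * s)
  · have hm : 0 < min (k 0) (k 1) := lt_min (hk 0) (hk 1)
    have hV : Tendsto (fun t => pathError f k (p t)) atTop (𝓝 0) := by
      refine tendsto_zero_of_dissipation (G := fun t => gainSq f k (p t))
        (N := fun t => ‖field f k (p t)‖) (w := fun t => p t 2) (w' := fun t => pdot t 2)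
        -- The factor `2 * s` is the amplitude in `hvel`; the rest comes from `deriv_pathError_le`.
        (A := 2 * (k 0 + k 1 + 2) * (2 * s)) (κ := r / 2) hs
        (by have := hk 0; have := hk 1; positivity) (half_pos hr) hm
        (V' := fun t => 2 * (k 0 * surface f 0 (p t) *
            (pdot t 0 - deriv (f 0) (p t 2) * pdot t 2) +
          k 1 * surface f 1 (p t) * (pdot t 1 - deriv (f 1) (p t 2) * pdot t 2)))
        ?_ ?_ ?_ (fun t ht => norm_pos_iff.2 (hχ t ht)) ?_
        (fun t _ => min_mul_pathError_le_gainSq _ hk) ?_ ?_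
      · intro t ht
        have h := ((hasDerivWithinAt_surface hd 0 (htraj.velocity t ht)).pow 2 |>.const_mul
          (k 0)).add ((hasDerivWithinAt_surface hd 1 (htraj.velocity t ht)).pow 2 |>.const_mul
          (k 1))
        refine h.congr_deriv ?_
        simp only [Fin.castSucc_zero, Fin.castSucc_one]
        push_cast
        ring
      · exact fun t ht => (EuclideanSpace.proj 2 : E3 →L[ℝ] ℝ).hasFDerivAt.comp_hasDerivWithinAt t
          (htraj.velocity t ht)
      · intro t _
        have := (hk 0).le; have := (hk 1).le
        rw [pathError]; positivity
      · intro t ht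
        refine (deriv_pathError_le hd hk hs (htraj.w_eq t ht) (hvel t ht)).trans_eq ?_
        ring
      · intro t ht
        rw [htraj.w_eq t ht, abs_mul, abs_of_pos hs]
        exact mul_le_mul_of_nonneg_left (abs_fieldHat_two_le hd _) hs.le
      · intro R M
        obtain ⟨B, hB⟩ := exists_norm_field_le hf hk R M
        exact ⟨B, fun t _ => hB (p t)⟩
    refine squeeze_zero (fun _ => Metric.infDist_nonneg)
      (fun t => infDist_physicalPath_le hk (p t)) ?_
    simpa using (hV.div_const (min (k 0) (k 1))).sqrt
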